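/- Let $\mathbb{F}$ be an algebraically closed field, and write $\mathbb{A}^n=\mathbb{F}^n$ with the Zariski topology. An affine variety in $\mathbb{A}^n$ is the set of common zeros of a set of polynomials in $\mathbb{F}[X_1,\dots,X_n]$ (not necessarily irreducible). Let $m\le n$, $k,\ell$ be nonnegative integers and $\epsilon\in\mathbb{R}$. A family of polynomial maps $\varphi_1,\dots,\varphi_\ell:\mathbb{A}^n\to\mathbb{A}^m$ is called an $(n,m,k,\epsilon)$ seeded rank extractor for varieties (resp. for subspaces) if for every affine variety (resp. linear subspace) $V\subseteq\mathbb{A}^n$ over $\mathbb{F}$ of dimension at least $k$, at most $\epsilon\ell$ of the indices $i\in\{1,\dots,\ell\}$ fail to satisfy $\dim\overline{\varphi_i(V)}=m$. It is called linear if every $\varphi_i$ is a linear map, i.e. is defined by homogeneous linear polynomials. 1. Every $(n,m,k,\epsilon)$ linear seeded rank extractor for subspaces is also an $(n,m,k,\epsilon)$ linear seeded rank extractor for varieties. 2. For every polynomial map $\varphi:\mathbb{A}^n\to\mathbb{A}^m$ and every affine variety $V\subseteq\mathbb{A}^n$, the condition $\dim\overline{\varphi(V)}=m$ is equivalent to $\varphi|_V:V\to\mathbb{A}^m$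 being dominant, i.e. $\overline{\varphi(V)}=\mathbb{A}^m$. So in 1, for every affine variety $V\subseteq\mathbb{A}^n$ of dimension at least $k$, all but at most an $\epsilon$ fraction of the maps $\varphi_i|_V:V\to\mathbb{A}^m$ are dominant. 3. Let $1\le m\le n$, let $\omega\in\mathbb{F}^\times$ have multiplicative order at least $n$ (possibly infinite), and let $s_1,\dots,s_\ell\in\mathbb{F}^\times$ be distinct. For $i\in\{1,\dots,\ell\}$ let $\varphi_i:\mathbb{A}^n\to\mathbb{A}^m$ be the linear map given by the $m\times n$ matrix $\bigl((\omega^{j'-1}s_i)^{j-1}\bigr)_{1\le j'\le m,\,1\le j\le n}$. Then $(\varphi_i)_{1\le i\le\ell}$ is a linear $(n,m,m,\epsilon)$ seeded rank extractor for varieties, where $\epsilon=m(n-m)/\ell$. -/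

import Mathlib

/-! Affine `n`-space over an algebraically closed field `F` is `Fin n → F`. -/

namespace RankExtractor

noncomputable section

/-- An affine variety in `𝔸ⁿ`: the set of common zeros of a set of polynomials
(not necessarily irreducible, possibly empty). -/
def IsAffineVariety {F : Type*} [Field F] {n : ℕ} (V : Set (Fin n → F)) : Prop :=
  ∃ S : Set (MvPolynomial (Fin n) F), V = {x | ∀ f ∈ S, MvPolynomial.eval x f = 0}

/-- An irreducible affine variety: nonempty and not the union of two proper subvarieties. -/
def IsIrreducibleVariety {F : Type*} [Field F] {n : ℕ} (V : Set (Fin n → F)) : Prop :=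
  IsAffineVariety V ∧ V.Nonempty ∧
    ∀ Z₁ Z₂ : Set (Fin n → F), IsAffineVariety Z₁ → IsAffineVariety Z₂ →
      V = Z₁ ∪ Z₂ → V = Z₁ ∨ V = Z₂

/-- The dimension of an affine variety `V`: the supremum of the lengths `d` of chains
`V₀ ⊊ V₁ ⊊ ⋯ ⊊ V_d` of irreducible affine subvarieties of `V`. It is `⊥` for `V = ∅`. -/
def dimension {F : Type*} [Field F] {n : ℕ} (V : Set (Fin n → F)) : WithBot ℕ∞ :=
  Order.krullDim {Z : Set (Fin n → F) // IsIrreducibleVariety Z ∧ Z ⊆ V}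

/-- The Zariski closure: the intersection of all affine varieties containing `S`. -/
def zariskiClosure {F : Type*} [Field F] {n : ℕ} (S : Set (Fin n → F)) : Set (Fin n → F) :=
  ⋂₀ {Z | IsAffineVariety Z ∧ S ⊆ Z}

/-- A polynomial map `𝔸ⁿ → 𝔸ᵐ`, given by the `m` polynomials that define it. -/
abbrev PolyMap (F : Type*) [Field F] (n m : ℕ) : Type _ :=
  Fin m → MvPolynomial (Fin n) F

/-- The map on points. -/
def PolyMap.toFun {F : Type*} [Field F] {n m : ℕ} (φ : PolyMap F n m)
    (x : Fin n → F) : Fin m → F :=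
  fun i => MvPolynomial.eval x (φ i)

/-- A polynomial map is linear if it is defined by (homogeneous) linear polynomials. -/
def PolyMap.IsLinear {F : Type*} [Field F] {n m : ℕ} (φ : PolyMap F n m) : Prop :=
  ∀ i, (φ i).IsHomogeneous 1

/-- The restriction `φ|_V : V → 𝔸ᵐ` is dominant. -/
def IsDominantOn {F : Type*} [Field F] {n m : ℕ} (φ : PolyMap F n m)
    (V : Set (Fin n → F)) : Prop :=
  zariskiClosure (φ.toFun '' V) = Set.univ

/-- `φ` has full rank on `V`: the closure of `φ(V)` has dimension `m`. -/
def HasFullRankOn {F : Type*} [Field F] {n m : ℕ} (φ : PolyMap F n m)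
    (V : Set (Fin n → F)) : Prop :=
  dimension (zariskiClosure (φ.toFun '' V)) = (m : WithBot ℕ∞)

/-- `(n, m, k, ε)` seeded rank extractors for varieties: for every affine variety of dimension
at least `k`, at most an `ε` fraction of the `ℓ` maps fail to have full rank on it. -/
def IsSeededRankExtractorForVarieties {F : Type*} [Field F] (n m k : ℕ) (ε : ℝ) {ℓ : ℕ}
    (φ : Fin ℓ → PolyMap F n m) : Prop :=
  m ≤ n ∧ ∀ V : Set (Fin n → F), IsAffineVariety V → (k : WithBot ℕ∞) ≤ dimension V →
    (({i : Fin ℓ | ¬ HasFullRankOn (φ i) V}.ncard : ℕ) : ℝ) ≤ ε * (ℓ : ℝ)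

/-- `(n, m, k, ε)` seeded rank extractors for linear subspaces. -/
def IsSeededRankExtractorForSubspaces {F : Type*} [Field F] (n m k : ℕ) (ε : ℝ) {ℓ : ℕ}
    (φ : Fin ℓ → PolyMap F n m) : Prop :=
  m ≤ n ∧ ∀ V : Submodule F (Fin n → F), k ≤ Module.finrank F V →
    (({i : Fin ℓ | ¬ HasFullRankOn (φ i) (V : Set (Fin n → F))}.ncard : ℕ) : ℝ) ≤ ε * (ℓ : ℝ)

/-- Linear seeded rank extractors for varieties. -/
def IsLinearSeededRankExtractorForVarieties {F : Type*} [Field F] (n m k : ℕ) (ε : ℝ) {ℓ : ℕ}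
    (φ : Fin ℓ → PolyMap F n m) : Prop :=
  (∀ i, (φ i).IsLinear) ∧ IsSeededRankExtractorForVarieties n m k ε φ

/-- Linear seeded rank extractors for subspaces. -/
def IsLinearSeededRankExtractorForSubspaces {F : Type*} [Field F] (n m k : ℕ) (ε : ℝ) {ℓ : ℕ}
    (φ : Fin ℓ → PolyMap F n m) : Prop :=
  (∀ i, (φ i).IsLinear) ∧ IsSeededRankExtractorForSubspaces n m k ε φ

/-- The Forbes–Shpilka map with parameters `ω` and `s`: the linear map of the `m × n` matrix
with entries `(ω ^ j' * s) ^ j`, the indices `j' < m`, `j < n` starting from `0`. -/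
def forbesShpilkaMap {F : Type*} [Field F] (n m : ℕ) (ω s : Fˣ) : PolyMap F n m :=
  fun j' => ∑ j : Fin n,
    MvPolynomial.C (((ω : F) ^ (j' : ℕ) * (s : F)) ^ (j : ℕ)) * MvPolynomial.X j

end

end RankExtractor

namespace RankExtractor

/-! ### Irreducible varieties, prime ideals and dimension -/

section

open MvPolynomial

section Geometry

variable {F : Type*} [Field F] {n : ℕ}

/-! The heart is a reduction from a variety to one of its spaces of tangent directions. Let `Z ⊆ V`
be irreducible of dimension at least `k`, with coordinate ring `R` and function field `K`. As `F` is
perfect, `Ω[K⁄F]` has rank equal to the transcendence degree of `K`, so at least `k`, and the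
differentials of the coordinates span it. Write them in a basis, clear denominators to get a matrix
`c` over `R`, and evaluate at a suitable point of `Z`: the column space `W` has dimension at least
`k`. If a linear map `A` sends `W` onto `F^m`, some `A * c * C` is the identity at that point, so
its determinant is nonzero in `K`. Hence the differentials of the forms `A x` are independent over
`K`, the forms are algebraically independent, and `A` is dominant on `Z`
(`exists_submodule_forall_algebraicIndependent`). The same `W` serves all seeds, so a seed that
fails on `V` also fails on `W`.

Full rank equals dominance because a chain of length `m` inside a proper subset of `𝔸ᵐ` could be
lengthened by `𝔸ᵐ` itself.

For the explicit family, it is enough to treat subspaces. Restricted to `m` echelon vectors of `W`,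
the map with seed `s` has determinant a power of `s` times a nonzero polynomial in `s` of degree at
most `m * (n - m)` (`seedPolynomial`). Every bad seed is one of its roots. -/

theorem isAffineVariety_zeroLocus (I : Ideal (MvPolynomial (Fin n) F)) :
    IsAffineVariety (zeroLocus F I) :=
  ⟨I, by ext; simp [mem_zeroLocus_iff]⟩

theorem IsAffineVariety.zeroLocus_vanishingIdeal {V : Set (Fin n → F)} (hV : IsAffineVariety V) :
    zeroLocus F (vanishingIdeal F V) = V := by
  obtain ⟨S, rfl⟩ := hV
  refine Set.Subset.antisymm (fun x hx f hf => ?_) (zeroLocus_vanishingIdeal_le _)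
  simpa using hx f (fun y hy => by simpa using hy f hf)

theorem subset_zariskiClosure (S : Set (Fin n → F)) : S ⊆ zariskiClosure S :=
  fun _ hx _ hZ => hZ.2 hx

theorem zariskiClosure_mono {S T : Set (Fin n → F)} (h : S ⊆ T) :
    zariskiClosure S ⊆ zariskiClosure T :=
  fun _ hx Z hZ => hx Z ⟨hZ.1, h.trans hZ.2⟩

/-- A set is Zariski dense as soon as only the zero polynomial vanishes on it. -/
theorem zariskiClosure_eq_univ {S : Set (Fin n → F)}
    (h : ∀ f : MvPolynomial (Fin n) F, (∀ x ∈ S, eval x f = 0) → f = 0) :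
    zariskiClosure S = Set.univ := by
  refine Set.eq_univ_of_forall fun x Z ⟨⟨T, hT⟩, hS⟩ => ?_
  rw [hT]
  intro f hf
  rw [h f fun y hy => (hT ▸ hS hy : y ∈ {x | ∀ f ∈ T, eval x f = 0}) f hf, map_zero]

/-- Only the zero polynomial vanishes on a Zariski dense set. -/
theorem eq_zero_of_zariskiClosure_eq_univ [Infinite F] {S : Set (Fin n → F)}
    (h : zariskiClosure S = Set.univ) {f : MvPolynomial (Fin n) F} (hf : ∀ x ∈ S, eval x f = 0) :
    f = 0 := by
  refine MvPolynomial.funext fun x => ?_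
  have hx : x ∈ zariskiClosure S := h ▸ Set.mem_univ x
  simpa using hx {x | ∀ g ∈ ({f} : Set (MvPolynomial (Fin n) F)), eval x g = 0}
    ⟨⟨_, rfl⟩, fun y hy => by simpa using hf y hy⟩

theorem IsIrreducibleVariety.isPrime_vanishingIdeal {Z : Set (Fin n → F)}
    (hZ : IsIrreducibleVariety Z) : (vanishingIdeal F Z).IsPrime := by
  obtain ⟨hV, ⟨z, hz⟩, hirr⟩ := hZ
  constructor
  · intro h
    have h1 : (1 : MvPolynomial (Fin n) F) ∈ vanishingIdeal F Z := h ▸ Submodule.mem_top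
    simpa using h1 z hz
  · intro f g hfg
    -- Adding `f` to the ideal cuts `Z` down to `Z ∩ {f = 0}`. If `f * g` vanishes on `Z`, the
    -- pieces for `f` and `g` cover `Z`, and irreducibility applies.
    have key (f : MvPolynomial (Fin n) F) :
        IsAffineVariety (zeroLocus F (vanishingIdeal F Z ⊔ Ideal.span {f})) ∧
        ∀ x, x ∈ zeroLocus F (vanishingIdeal F Z ⊔ Ideal.span {f}) ↔ x ∈ Z ∧ eval x f = 0 := by
      refine ⟨isAffineVariety_zeroLocus _, fun x => ⟨fun hx => ⟨?_, ?_⟩, fun hx p hp => ?_⟩⟩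
      · rw [← hV.zeroLocus_vanishingIdeal]
        exact zeroLocus_anti_mono le_sup_left hx
      · simpa using
          hx f (Ideal.mem_sup_right (Ideal.mem_span_singleton_self f))
      · obtain ⟨a, ha, b, hb, rfl⟩ := Submodule.mem_sup.mp hp
        obtain ⟨c, rfl⟩ := Ideal.mem_span_singleton.mp hb
        rw [map_add, ha x hx.1, map_mul]
        simp [hx.2]
    have hmem (f : MvPolynomial (Fin n) F)
        (h : Z = zeroLocus F (vanishingIdeal F Z ⊔ Ideal.span {f})) :
        f ∈ vanishingIdeal F Z := fun x hx => by
      rw [h] at hx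
      simpa using (((key f).2 x).mp hx).2
    refine (hirr _ _ (key f).1 (key g).1 ?_).imp (hmem f) (hmem g)
    ext x
    rw [Set.mem_union, (key f).2, (key g).2, ← and_or_left]
    refine ⟨fun hx => ⟨hx, ?_⟩, And.left⟩
    have := hfg x hx
    simpa using this

/-- The dimension of `V` is bounded by the Krull dimension of its coordinate ring. -/
theorem dimension_le_ringKrullDim (V : Set (Fin n → F)) :
    dimension V ≤ ringKrullDim (MvPolynomial (Fin n) F ⧸ vanishingIdeal F V) := by
  rw [ringKrullDim_quotient, ← Order.krullDim_orderDual]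
  refine Order.krullDim_le_of_strictMono (fun Z => OrderDual.toDual
    ⟨⟨vanishingIdeal F Z.1, Z.2.1.isPrime_vanishingIdeal⟩, vanishingIdeal_anti_mono Z.2.2⟩)
    fun Z₁ Z₂ h => ?_
  refine lt_of_le_of_ne (vanishingIdeal_anti_mono h.le) fun heq => h.ne (Subtype.ext ?_)
  rw [← Z₁.2.1.1.zeroLocus_vanishingIdeal, ← Z₂.2.1.1.zeroLocus_vanishingIdeal]
  have := congrArg (fun P => (OrderDual.ofDual P).1.asIdeal) heq
  exact congrArg (zeroLocus F) this

/-- The top member of a chain of length `k` in `V` is irreducible and contains the whole chain. -/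
theorem exists_irreducible_le_dimension {V : Set (Fin n → F)} {k : ℕ}
    (h : (k : WithBot ℕ∞) ≤ dimension V) :
    ∃ Z, IsIrreducibleVariety Z ∧ Z ⊆ V ∧ (k : WithBot ℕ∞) ≤ dimension Z := by
  obtain ⟨l, rfl⟩ := Order.le_krullDim_iff.mp h
  refine ⟨l.last.1, l.last.2.1, l.last.2.2, Order.le_krullDim_iff.mpr ⟨LTSeries.mk l.length
    (fun i => ⟨(l i).1, (l i).2.1, l.strictMono.monotone (Fin.le_last i)⟩) fun i j hij => ?_, rfl⟩⟩
  exact l.strictMono hij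

theorem ringKrullDim_mvPolynomial_fin : ringKrullDim (MvPolynomial (Fin n) F) = n := by
  simp

variable [IsAlgClosed F]

/-- By the Nullstellensatz `P` is the full vanishing ideal of its zero locus. A covering by two
varieties then puts the product of their ideals inside `P`, and primality chooses one. -/
theorem isIrreducibleVariety_zeroLocus (P : Ideal (MvPolynomial (Fin n) F)) [hP : P.IsPrime] :
    IsIrreducibleVariety (zeroLocus F P) := by
  have hvan : vanishingIdeal F (zeroLocus F P) = P := IsPrime.vanishingIdeal_zeroLocus P
  refine ⟨isAffineVariety_zeroLocus P, ?_, fun Z₁ Z₂ h₁ h₂ h => ?_⟩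
  · by_contra hne
    rw [Set.not_nonempty_iff_eq_empty] at hne
    rw [hne, vanishingIdeal_empty] at hvan
    exact hP.ne_top hvan.symm
  · have hle : vanishingIdeal F Z₁ * vanishingIdeal F Z₂ ≤ P := by
      rw [← hvan, h, Ideal.mul_le]
      rintro f hf g hg x (hx | hx)
      · rw [map_mul, hf x hx, zero_mul]
      · rw [map_mul, hg x hx, mul_zero]
    refine (hP.mul_le.mp hle).imp (fun h' => ?_) fun h' => ?_
    · refine Set.Subset.antisymm ?_ (h ▸ Set.subset_union_left)
      rw [← h₁.zeroLocus_vanishingIdeal]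
      exact zeroLocus_anti_mono h'
    · refine Set.Subset.antisymm ?_ (h ▸ Set.subset_union_right)
      rw [← h₂.zeroLocus_vanishingIdeal]
      exact zeroLocus_anti_mono h'

theorem isIrreducibleVariety_univ : IsIrreducibleVariety (Set.univ : Set (Fin n → F)) := by
  have := isIrreducibleVariety_zeroLocus (⊥ : Ideal (MvPolynomial (Fin n) F))
  rwa [zeroLocus_bot] at this

/-- The Nullstellensatz makes `zeroLocus` strictly antitone on primes, so chains of primes in the
polynomial ring become chains of irreducible varieties. The other inequality comes from the
coordinate ring. -/
theorem dimension_univ : dimension (Set.univ : Set (Fin n → F)) = n := by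
  rw [← ringKrullDim_mvPolynomial_fin (F := F) (n := n)]
  refine le_antisymm ((dimension_le_ringKrullDim _).trans (ringKrullDim_quotient_le _)) ?_
  rw [ringKrullDim, ← Order.krullDim_orderDual]
  refine Order.krullDim_le_of_strictMono (fun P => ⟨zeroLocus F (OrderDual.ofDual P).asIdeal,
    isIrreducibleVariety_zeroLocus _, Set.subset_univ _⟩) fun P Q h => ?_
  refine lt_of_le_of_ne (zeroLocus_anti_mono h.le) fun heq => h.ne ?_
  have := congrArg (fun Z => vanishingIdeal F Z.1) heq
  simp only [IsPrime.vanishingIdeal_zeroLocus] at this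
  exact PrimeSpectrum.ext this

/-- The only subset of `𝔸ⁿ` of dimension `n` is `𝔸ⁿ` itself. -/
theorem dimension_eq_iff_eq_univ {X : Set (Fin n → F)} :
    dimension X = n ↔ X = Set.univ := by
  refine ⟨fun h => ?_, fun h => h ▸ dimension_univ⟩
  by_contra hne
  obtain ⟨l, hl⟩ := Order.le_krullDim_iff.mp h.ge
  have hlast : (l.last : Set (Fin n → F)) ≠ Set.univ := fun heq =>
    hne (Set.eq_univ_of_univ_subset (heq ▸ l.last.2.2))
  -- Appending `𝔸ⁿ` to a chain of length `n` inside `X ≠ 𝔸ⁿ` gives a chain of length `n + 1` in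
  -- `𝔸ⁿ`.
  let l' := (l.map (β := {Z : Set (Fin n → F) // IsIrreducibleVariety Z ∧ Z ⊆ Set.univ})
    (fun Z => ⟨Z.1, Z.2.1, Set.subset_univ _⟩) (fun _ _ h => h)).snoc
    ⟨Set.univ, isIrreducibleVariety_univ, subset_rfl⟩
    (lt_of_le_of_ne (Set.subset_univ _) fun heq => hlast heq)
  have := Order.le_krullDim_iff.mpr ⟨l', rfl⟩
  have h2 : ((n + 1 : ℕ) : WithBot ℕ∞) ≤ (n : ℕ) := by
    rw [← dimension_univ (F := F) (n := n)]
    refine le_of_eq_of_le (congrArg _ ?_) this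
    simp [l', LTSeries.map, hl]
  exact absurd (Nat.cast_le.mp h2) (by omega)

theorem hasFullRankOn_iff_isDominantOn {m : ℕ} (φ : PolyMap F n m) (V : Set (Fin n → F)) :
    HasFullRankOn φ V ↔ IsDominantOn φ V :=
  dimension_eq_iff_eq_univ

end Geometry

end

/-! ### Differentials and algebraic independence over a perfect field -/

section

open scoped TensorProduct
open KaehlerDifferential

universe u v

open scoped IntermediateField.algebraAdjoinAdjoin in
/-- If `K` is separable over the field generated by the algebraically independent family `x`, then
`K` is formally étale over the polynomial ring in that family. -/
theorem formallyEtale_mvPolynomial_of_algebraicIndependent {k : Type u} {K : Type v} [Field k]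
    [Field K] [Algebra k K] {ι : Type v} {x : ι → K} (hx : AlgebraicIndependent k x)
    (hsep : Algebra.IsSeparable (IntermediateField.adjoin k (Set.range x)) K)
    [Algebra (MvPolynomial ι k) K]
    (halg : ∀ p : MvPolynomial ι k, algebraMap (MvPolynomial ι k) K p = MvPolynomial.aeval x p) :
    Algebra.FormallyEtale (MvPolynomial ι k) K := by
  -- Each step of the tower from the polynomial ring to `k[x]`, `k(x)` and `K` is formally étale: an
  -- isomorphism, a localization, a separable extension.
  let e := hx.aevalEquiv
  let : Algebra (MvPolynomial ι k) (Algebra.adjoin k (Set.range x)) := e.toRingHom.toAlgebra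
  have h₁ : Algebra.FormallyEtale (MvPolynomial ι k) (Algebra.adjoin k (Set.range x)) :=
    .of_equiv (AlgEquiv.ofRingEquiv (f := e.toRingEquiv) fun _ => rfl)
  have h₂ : Algebra.FormallyEtale (Algebra.adjoin k (Set.range x))
      (IntermediateField.adjoin k (Set.range x)) := .of_isLocalization (nonZeroDivisors _)
  have h₃ : Algebra.FormallyEtale (IntermediateField.adjoin k (Set.range x)) K :=
    .of_isSeparable _ _
  have h₄ : Algebra.FormallyEtale (Algebra.adjoin k (Set.range x)) K :=
    .comp _ (IntermediateField.adjoin k (Set.range x)) _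
  have : IsScalarTower (MvPolynomial ι k) (Algebra.adjoin k (Set.range x)) K := by
    refine .of_algebraMap_eq fun p => ?_
    rw [halg]
    exact (hx.algebraMap_aevalEquiv p).symm
  exact .comp _ (Algebra.adjoin k (Set.range x)) _

/-- Formal étaleness identifies `Ω[K⁄k]` with the base change of the differentials of the polynomial
ring, which are free on the `dX_i`. -/
theorem rank_kaehlerDifferential_of_isSeparable {k : Type u} {K : Type v} [Field k] [Field K]
    [Algebra k K] {ι : Type v} {x : ι → K} (hx : AlgebraicIndependent k x)
    (hsep : Algebra.IsSeparable (IntermediateField.adjoin k (Set.range x)) K) :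
    Module.rank K Ω[K⁄k] = Cardinal.mk ι := by
  let : Algebra (MvPolynomial ι k) K := (MvPolynomial.aeval (R := k) x).toRingHom.toAlgebra
  have : IsScalarTower k (MvPolynomial ι k) K := by
    refine .of_algebraMap_eq fun a => ?_
    exact ((MvPolynomial.aeval (R := k) x).commutes a).symm
  have := formallyEtale_mvPolynomial_of_algebraicIndependent hx hsep fun _ => rfl
  let b := ((mvPolynomialBasis k ι).baseChange K).map
    (tensorKaehlerEquivOfFormallyEtale k (MvPolynomial ι k) K)
  exact b.mk_eq_rank''.symm

/-- Over a perfect field, the module of differentials of a finitely generated field extension has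
rank equal to the transcendence degree. -/
theorem rank_kaehlerDifferential_eq_trdeg (k K : Type*) [Field k] [Field K] [Algebra k K]
    [PerfectField k] [Algebra.EssFiniteType k K] :
    Module.rank K Ω[K⁄k] = Algebra.trdeg k K := by
  obtain ⟨s, hs, hsep⟩ := exists_isTranscendenceBasis_and_isSeparable_of_perfectField k K
  rw [← hs.cardinalMk_eq_trdeg]
  exact rank_kaehlerDifferential_of_isSeparable hs.1 (by convert hsep <;> simp)

/-- Independent differentials force `m ≤ rank Ω[E⁄k] = trdeg E`. Since `E` is algebraic over the `m`
elements `z`, they must form a transcendence basis. -/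
theorem algebraicIndependent_of_linearIndependent_D_of_adjoin_eq_top {k E K : Type*} [Field k]
    [Field E] [Field K] [Algebra k E] [Algebra k K] [Algebra E K] [IsScalarTower k E K]
    [PerfectField k] {m : ℕ} {z : Fin m → E} (hz : IntermediateField.adjoin k (Set.range z) = ⊤)
    (hD : LinearIndependent K fun i => D k K (algebraMap E K (z i))) :
    AlgebraicIndependent k z := by
  have : Algebra.EssFiniteType k E :=
    IntermediateField.fg_top_iff.mp ⟨(Set.finite_range z).toFinset, by simpa using hz⟩
  have hDz : LinearIndependent E fun i => D k E (z i) := by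
    refine LinearIndependent.of_comp (KaehlerDifferential.map k k E K) ?_
    convert hD.restrict_scalars' E with i
    simp
  have hcard := hDz.cardinal_lift_le_rank
  rw [rank_kaehlerDifferential_eq_trdeg k E] at hcard
  have : Algebra.IsAlgebraic (Algebra.adjoin k (Set.range z)) E := by
    rw [← IntermediateField.isAlgebraic_adjoin_iff_top, hz, Algebra.isAlgebraic_iff_isIntegral]
    exact Algebra.isIntegral_of_surjective IntermediateField.topEquiv.surjective
  exact (Algebra.IsAlgebraic.isTranscendenceBasis_of_lift_le_trdeg_of_finite k z hcard).1

/-- Over a perfect field, elements with linearly independent differentials are algebraically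
independent. -/
theorem algebraicIndependent_of_linearIndependent_D {k K : Type*} [Field k] [Field K] [Algebra k K]
    [PerfectField k] {m : ℕ} {y : Fin m → K} (hy : LinearIndependent K fun i => D k K (y i)) :
    AlgebraicIndependent k y := by
  -- `K` need not be finitely generated over `k`, as the rank formula requires, so the argument
  -- takes place in `k(y)`.
  let E := IntermediateField.adjoin k (Set.range y)
  let z : Fin m → E := fun i => ⟨y i, IntermediateField.subset_adjoin _ _ ⟨i, rfl⟩⟩
  have hz : IntermediateField.adjoin k (Set.range z) = ⊤ := by
    apply IntermediateField.map_injective E.val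
    rw [IntermediateField.adjoin_map, ← Set.range_comp, ← AlgHom.fieldRange_eq_map,
      IntermediateField.fieldRange_val]
    rfl
  exact (algebraicIndependent_of_linearIndependent_D_of_adjoin_eq_top hz hy).map' (f := E.val)
    E.val.injective

end

/-! ### Transcendence degree and differentials of the function field -/

section

open MvPolynomial KaehlerDifferential

/-- The Krull dimension of a finitely generated domain is at most the transcendence degree of its
fraction field. -/
theorem le_trdeg_of_le_ringKrullDim {k R K : Type*} [Field k] [CommRing R] [IsDomain R] [Algebra k R]
    [Algebra.FiniteType k R] [Field K] [Algebra k K] [Algebra R K] [IsScalarTower k R K]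
    [IsFractionRing R K] {d : ℕ} (h : (d : WithBot ℕ∞) ≤ ringKrullDim R) :
    (d : Cardinal) ≤ Algebra.trdeg k K := by
  -- Noether normalization: `R` is integral over `s` variables, so incomparability of primes bounds
  -- its dimension by `s`, while the variables stay algebraically independent in `K`.
  obtain ⟨s, g, hinj, hg⟩ := exists_integral_inj_algHom_of_fg k R
  have hds : d ≤ s := by
    algebraize [g.toRingHom]
    have hle : ringKrullDim R ≤ ringKrullDim (MvPolynomial (Fin s) k) :=
      Order.krullDim_le_of_strictMono (PrimeSpectrum.comap (algebraMap _ R)) fun P Q hPQ =>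
        Ideal.IsIntegral.comap_lt_comap (I := P.asIdeal) hPQ
    rw [ringKrullDim_mvPolynomial_fin] at hle
    exact Nat.cast_le.mp (h.trans hle)
  have hcomp : Function.Injective ((IsScalarTower.toAlgHom k R K).comp g) :=
    (IsFractionRing.injective R K).comp hinj
  have := ((algebraicIndependent_X (Fin s) k).map' hcomp).lift_cardinalMk_le_trdeg
  rw [Cardinal.mk_fin, Cardinal.lift_natCast, Cardinal.lift_id'] at this
  exact le_trans (Nat.cast_le.mpr hds) this

/-- The differentials of generators of a domain span the differentials of its fraction field. -/
theorem span_D_eq_top {k R K : Type*} [Field k] [CommRing R] [IsDomain R] [Algebra k R]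
    [Field K] [Algebra k K] [Algebra R K] [IsScalarTower k R K] [IsFractionRing R K] {ι : Type*}
    (x : ι → R) (hx : Function.Surjective (aeval (R := k) x)) :
    Submodule.span K (Set.range fun i => D k K (algebraMap R K (x i))) = ⊤ := by
  set N := Submodule.span K (Set.range fun i => D k K (algebraMap R K (x i)))
  have hR (a : R) : D k K (algebraMap R K a) ∈ N := by
    obtain ⟨p, rfl⟩ := hx a
    induction p using MvPolynomial.induction_on with
    | C c =>
      rw [aeval_C, ← IsScalarTower.algebraMap_apply, Derivation.map_algebraMap]
      exact N.zero_mem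
    | add p q hp hq => simpa using N.add_mem hp hq
    | mul_X p i hp =>
      rw [map_mul, map_mul, Derivation.leibniz, aeval_X]
      exact N.add_mem (N.smul_mem _ (Submodule.subset_span ⟨i, rfl⟩)) (N.smul_mem _ hp)
  rw [eq_top_iff, ← span_range_derivation, Submodule.span_le]
  rintro _ ⟨c, rfl⟩
  obtain ⟨a, b, hb, rfl⟩ := IsFractionRing.div_surjective (A := R) c
  have hb0 : algebraMap R K b ≠ 0 := IsFractionRing.to_map_ne_zero_of_mem_nonZeroDivisors hb
  -- The quotient rule, obtained by differentiating `b * (a / b) = a`.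
  have h := (D k K).leibniz (algebraMap R K b) (algebraMap R K a / algebraMap R K b)
  rw [mul_div_cancel₀ _ hb0] at h
  have h' : algebraMap R K b • D k K (algebraMap R K a / algebraMap R K b) ∈ N := by
    rw [← sub_eq_iff_eq_add] at h
    rw [← h]
    exact N.sub_mem (hR a) (N.smul_mem _ (hR b))
  exact (N.smul_mem_iff hb0).mp h'

/-- Expanding differentials in a basis: the rows of `A * B` control linear independence. -/
theorem linearIndependent_of_det_ne_zero {K M : Type*} [Field K] [AddCommGroup M] [Module K M]
    {κ : Type*} [Fintype κ] {n m : ℕ} (b : Module.Basis κ K M) (ω : Fin n → M)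
    (A : Matrix (Fin m) (Fin n) K) (C : Matrix κ (Fin m) K) (g : K)
    (h : (A * (g • Matrix.of fun i j => b.repr (ω i) j) * C).det ≠ 0) :
    LinearIndependent K fun i => ∑ j, A i j • ω j := by
  rw [Fintype.linearIndependent_iff]
  intro v hv
  have h0 : Matrix.vecMul v (A * (g • Matrix.of fun i j => b.repr (ω i) j) * C) = 0 := by
    rw [Matrix.mul_smul, Matrix.smul_mul, Matrix.vecMul_smul, ← Matrix.vecMul_vecMul]
    have : Matrix.vecMul v (A * Matrix.of fun i j => b.repr (ω i) j) = 0 := by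
      ext j
      have := congrArg (fun w => b.repr w j) hv
      simpa [Matrix.vecMul, dotProduct, Matrix.mul_apply] using this
    rw [this, Matrix.zero_vecMul, smul_zero]
  exact congrFun (Matrix.eq_zero_of_vecMul_eq_zero h h0)

end

/-! ### Specialization at a point: from a variety to a linear space -/

section

open MvPolynomial KaehlerDifferential

/-- Let `x` generate a domain `R` over a perfect field and let `c / g` express the differentials of
all the `x i` in a basis of differentials. Whenever the specialization of `c` at a ring homomorphism
to the base field is mapped onto the whole space by a matrix `A`, the linear forms `A x` are
algebraically independent. -/
theorem algebraicIndependent_of_specialization {k R K : Type*} [Field k] [PerfectField k] [CommRing R]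
    [IsDomain R] [Algebra k R] [Field K] [Algebra k K] [Algebra R K] [IsScalarTower k R K]
    [IsFractionRing R K] {n m : ℕ} {κ : Type*} [Fintype κ] (x : Fin n → R)
    (b : Module.Basis κ K Ω[K⁄k]) (g : R) (c : Matrix (Fin n) κ R)
    (hc : ∀ i j, algebraMap R K (c i j) =
      algebraMap R K g * b.repr (D k K (algebraMap R K (x i))) j)
    (ev : R →ₐ[k] k) (A : Matrix (Fin m) (Fin n) k)
    (hA : Function.Surjective (A * c.map ev).mulVec) :
    AlgebraicIndependent k fun i => ∑ j, A i j • x j := by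
  obtain ⟨C, hC⟩ := Matrix.mulVec_surjective_iff_exists_right_inverse.mp hA
  -- `C` is a right inverse of the specialized `A * c`, so `M` specializes to the identity and its
  -- determinant cannot be zero in `R`.
  let M : Matrix (Fin m) (Fin m) R := A.map (algebraMap k R) * c * C.map (algebraMap k R)
  have hev : M.map ev = 1 := by
    have hk (B : Matrix (Fin m) (Fin n) k) : (B.map (algebraMap k R)).map ev = B := by
      ext; simp
    have hk' (B : Matrix κ (Fin m) k) : (B.map (algebraMap k R)).map ev = B := by
      ext; simp
    simp only [M]
    rw [Matrix.map_mul, Matrix.map_mul, hk, hk', hC]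
  have hM : M.det ≠ 0 := fun h => by
    have := AlgHom.map_det ev M
    rw [h, map_zero, AlgHom.mapMatrix_apply, hev, Matrix.det_one] at this
    exact zero_ne_one this
  have hMK : (M.map (algebraMap R K)).det ≠ 0 := by
    rw [← RingHom.mapMatrix_apply, ← RingHom.map_det]
    exact (map_ne_zero_iff _ (IsFractionRing.injective R K)).mpr hM
  have hD : LinearIndependent K fun i => D k K (algebraMap R K (∑ j, A i j • x j)) := by
    have := linearIndependent_of_det_ne_zero b (fun i => D k K (algebraMap R K (x i)))
      (A.map (algebraMap k K)) (C.map (algebraMap k K)) (algebraMap R K g) (by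
        convert hMK
        simp only [M]
        rw [Matrix.map_mul, Matrix.map_mul]
        congr 2
        · ext; simp [← IsScalarTower.algebraMap_apply]
        · ext; simp [hc]
        · ext; simp [← IsScalarTower.algebraMap_apply])
    convert this with i
    simp only [map_sum, Matrix.map_apply, algebraMap_smul]
    refine Finset.sum_congr rfl fun j _ => ?_
    rw [show algebraMap R K (A i j • x j) = A i j • algebraMap R K (x j) from
      map_smul (IsScalarTower.toAlgHom k R K) _ _, Derivation.map_smul]
  exact AlgebraicIndependent.of_comp (IsScalarTower.toAlgHom k R K)
    (algebraicIndependent_of_linearIndependent_D hD)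

/-- An irreducible variety of dimension at least `d` has a point with a `d`-dimensional space of
tangent directions such that every linear map that is onto on this space
is given by algebraically independent functions on the variety. -/
theorem exists_submodule_forall_algebraicIndependent {F : Type*} [Field F] [IsAlgClosed F] {n d : ℕ}
    {Z : Set (Fin n → F)} (hZ : IsIrreducibleVariety Z) (hd : (d : WithBot ℕ∞) ≤ dimension Z) :
    ∃ W : Submodule F (Fin n → F), d ≤ Module.finrank F W ∧
      ∀ (m : ℕ) (A : Matrix (Fin m) (Fin n) F), (∀ y, ∃ w ∈ W, A.mulVec w = y) →
        AlgebraicIndependent F fun i =>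
          ∑ j, A i j • (Ideal.Quotient.mk (vanishingIdeal F Z) (X j)) := by
  have hprime := hZ.isPrime_vanishingIdeal
  let R := MvPolynomial (Fin n) F ⧸ vanishingIdeal F Z
  let K := FractionRing R
  let x : Fin n → R := fun j => Ideal.Quotient.mk _ (X j)
  have hx : aeval (R := F) x = Ideal.Quotient.mkₐ F (vanishingIdeal F Z) := by
    ext j; rw [aeval_X]; rfl
  have hspan := span_D_eq_top (K := K) x (hx ▸ Ideal.Quotient.mkₐ_surjective _ _)
  have htr : (d : Cardinal) ≤ Algebra.trdeg F K :=
    le_trdeg_of_le_ringKrullDim (R := R) (hd.trans (dimension_le_ringKrullDim Z))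
  have : Algebra.EssFiniteType F K := .comp F R K
  rw [← rank_kaehlerDifferential_eq_trdeg] at htr
  -- The basis is picked among the coordinate differentials themselves, so that rows `a j` of the
  -- coefficient matrix are known exactly.
  obtain ⟨κ, a, hainj, haspan, hali⟩ := exists_linearIndependent' K
    (fun i => D F K (algebraMap R K (x i)))
  rw [hspan] at haspan
  let b := Module.Basis.mk hali haspan.ge
  have : Finite κ := .of_injective a hainj
  have := Fintype.ofFinite κ
  classical
  have hcard : d ≤ Fintype.card κ := by
    rw [rank_eq_card_basis b] at htr
    exact_mod_cast htr
  obtain ⟨g, hg⟩ := IsLocalization.exist_integer_multiples_of_finite (nonZeroDivisors R)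
    (fun ij : Fin n × κ => b.repr (D F K (algebraMap R K (x ij.1))) ij.2)
  choose c hc using hg
  have hcb (i j) : algebraMap R K (c (i, j)) =
      algebraMap R K g * b.repr (D F K (algebraMap R K (x i))) j := by
    rw [hc (i, j), Algebra.smul_def]
  -- With common denominator `g`, the rows indexed by `a` form `g` times the identity. Hence `c`
  -- keeps full column rank at any point where `g` does not vanish.
  have hca (j' j) : c (a j', j) = if j' = j then (g : R) else 0 := by
    apply IsFractionRing.injective R K
    have : D F K (algebraMap R K (x (a j'))) = b j' := by simp [b]
    rw [hcb, this, b.repr_self, Finsupp.single_apply]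
    split_ifs <;> simp
  obtain ⟨g', hg'⟩ := Ideal.Quotient.mk_surjective (g : R)
  obtain ⟨p, hpZ, hp⟩ : ∃ p ∈ Z, eval p g' ≠ 0 := by
    by_contra! h
    refine nonZeroDivisors.coe_ne_zero g ?_
    rw [← hg', Ideal.Quotient.eq_zero_iff_mem]
    simpa using h
  let ev : R →ₐ[F] F := Ideal.Quotient.liftₐ _ (aeval p) fun f hf => hf p hpZ
  have hevg : ev g ≠ 0 := by
    rw [← hg']
    exact hp
  let cm : Matrix (Fin n) κ R := Matrix.of fun i j => c (i, j)
  refine ⟨LinearMap.range (cm.map ev).mulVecLin, ?_, fun m A hA => ?_⟩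
  · rw [LinearMap.finrank_range_of_inj, Module.finrank_fintype_fun_eq_card]
    · exact hcard
    · rw [← LinearMap.ker_eq_bot, LinearMap.ker_eq_bot']
      intro v hv
      ext j
      have := congrFun hv (a j)
      simp only [Matrix.mulVecLin_apply, Matrix.mulVec, dotProduct, Matrix.map_apply, cm,
        Matrix.of_apply, hca] at this
      simpa [hevg, apply_ite ev] using this
  · refine algebraicIndependent_of_specialization x b g cm hcb ev A fun y => ?_
    obtain ⟨_, ⟨v, rfl⟩, hv⟩ := hA y
    exact ⟨v, by rw [← hv, Matrix.mulVecLin_apply, Matrix.mulVec_mulVec]⟩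

end

/-! ### Linear maps: from subspaces to varieties -/

section

open MvPolynomial

section Linear

variable {F : Type*} [Field F] {n m : ℕ}

/-- The matrix of the linear part of a polynomial map. -/
noncomputable def PolyMap.matrix (φ : PolyMap F n m) : Matrix (Fin m) (Fin n) F :=
  Matrix.of fun i j => coeff (Finsupp.single j 1) (φ i)

theorem eq_sum_of_isHomogeneous_one {f : MvPolynomial (Fin n) F} (hf : f.IsHomogeneous 1) :
    f = ∑ j, C (coeff (Finsupp.single j 1) f) * X j := by
  ext d
  simp only [coeff_sum, coeff_C_mul, coeff_X]
  by_cases hd : d.degree = 1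
  · obtain ⟨j, rfl⟩ := (Finsupp.sum_eq_one_iff d).mp hd
    simp [Finsupp.single_left_inj]
  · rw [hf.coeff_eq_zero hd]
    refine (Finset.sum_eq_zero fun j _ => ?_).symm
    rw [if_neg, mul_zero]
    rintro rfl
    simp at hd

theorem PolyMap.IsLinear.toFun_eq {φ : PolyMap F n m} (hφ : φ.IsLinear) (x : Fin n → F) :
    φ.toFun x = φ.matrix.mulVec x := by
  ext i
  rw [PolyMap.toFun, eq_sum_of_isHomogeneous_one (hφ i)]
  simp [PolyMap.matrix, Matrix.mulVec, dotProduct]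

theorem PolyMap.IsLinear.eq_sum_smul {φ : PolyMap F n m} (hφ : φ.IsLinear) (i : Fin m) :
    φ i = ∑ j, φ.matrix i j • X j := by
  conv_lhs => rw [eq_sum_of_isHomogeneous_one (hφ i)]
  simp [PolyMap.matrix, smul_eq_C_mul]

/-- A linear map that is dominant on a subspace is onto on it. -/
theorem IsDominantOn.surjective_of_isLinear [Infinite F] {φ : PolyMap F n m} (hφ : φ.IsLinear)
    {W : Submodule F (Fin n → F)} (h : IsDominantOn φ (W : Set (Fin n → F))) (y : Fin m → F) :
    ∃ w ∈ W, φ.matrix.mulVec w = y := by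
  suffices W.map φ.matrix.mulVecLin = ⊤ by
    simpa using (this ▸ Submodule.mem_top : y ∈ W.map φ.matrix.mulVecLin)
  by_contra hne
  -- A proper image lies in the kernel of a nonzero functional. Read as a linear polynomial, the
  -- functional vanishes on a dense set, a contradiction.
  obtain ⟨f, hf0, hf⟩ := Submodule.exists_le_ker_of_lt_top _ (lt_top_iff_ne_top.mpr hne)
  have hfe (z : Fin m → F) : f z = ∑ j, f (Pi.single j 1) * z j := by
    conv_lhs => rw [pi_eq_sum_univ' z]
    simp [mul_comm]
  refine hf0 (LinearMap.ext fun z => ?_)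
  have h0 : (∑ j, C (f (Pi.single j 1)) * X j : MvPolynomial (Fin m) F) = 0 := by
    refine eq_zero_of_zariskiClosure_eq_univ h ?_
    rintro _ ⟨w, hw, rfl⟩
    have := hf ⟨w, hw, rfl⟩
    rw [LinearMap.mem_ker, hfe] at this
    simpa [hφ.toFun_eq] using this
  rw [hfe]
  simpa using congrArg (eval z) h0

theorem isDominantOn_of_surjective {φ : PolyMap F n m} {V : Set (Fin n → F)}
    (h : ∀ y, ∃ x ∈ V, φ.toFun x = y) : IsDominantOn φ V :=
  Set.eq_univ_of_univ_subset (Set.Subset.trans (fun y _ => h y) (subset_zariskiClosure _))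

theorem IsDominantOn.mono {φ : PolyMap F n m} {V V' : Set (Fin n → F)} (h : IsDominantOn φ V)
    (hV : V ⊆ V') : IsDominantOn φ V' :=
  Set.eq_univ_of_univ_subset (h.ge.trans (zariskiClosure_mono (Set.image_mono hV)))

/-- A polynomial map whose coordinates are algebraically independent functions is dominant. -/
theorem isDominantOn_of_algebraicIndependent {φ : PolyMap F n m} {V : Set (Fin n → F)}
    (h : AlgebraicIndependent F fun i => Ideal.Quotient.mkₐ F (vanishingIdeal F V) (φ i)) :
    IsDominantOn φ V := by
  refine zariskiClosure_eq_univ fun f hf => ?_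
  refine h.eq_zero_of_aeval_eq_zero f ?_
  have hcomp : aeval (fun i => Ideal.Quotient.mkₐ F (vanishingIdeal F V) (φ i)) f =
      Ideal.Quotient.mkₐ F (vanishingIdeal F V) (aeval φ f) := by
    rw [← AlgHom.comp_apply, comp_aeval]
  rw [hcomp]
  refine Ideal.Quotient.eq_zero_iff_mem.mpr fun x hx => ?_
  rw [← AlgHom.comp_apply, comp_aeval]
  exact hf _ ⟨x, hx, rfl⟩

/-- Every variety `V` of dimension at least `k` admits a subspace of dimension at least `k` such
that linear maps of full rank on the subspace have full rank on `V`. -/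
theorem exists_submodule_hasFullRankOn [IsAlgClosed F] {V : Set (Fin n → F)} {k : ℕ}
    (h : (k : WithBot ℕ∞) ≤ dimension V) :
    ∃ W : Submodule F (Fin n → F), k ≤ Module.finrank F W ∧
      ∀ {m : ℕ} (φ : PolyMap F n m), φ.IsLinear → HasFullRankOn φ (W : Set (Fin n → F)) →
        HasFullRankOn φ V := by
  obtain ⟨Z, hZ, hZV, hk⟩ := exists_irreducible_le_dimension h
  obtain ⟨W, hW, hind⟩ := exists_submodule_forall_algebraicIndependent hZ hk
  refine ⟨W, hW, fun φ hφ hφW => ?_⟩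
  rw [hasFullRankOn_iff_isDominantOn] at hφW ⊢
  refine IsDominantOn.mono (isDominantOn_of_algebraicIndependent ?_) hZV
  convert hind _ φ.matrix (hφW.surjective_of_isLinear hφ) with i
  rw [hφ.eq_sum_smul i, map_sum]
  rfl

theorem isLinearSeededRankExtractorForVarieties_of_subspaces [IsAlgClosed F] {k ℓ : ℕ} {ε : ℝ}
    {φ : Fin ℓ → PolyMap F n m} (h : IsLinearSeededRankExtractorForSubspaces n m k ε φ) :
    IsLinearSeededRankExtractorForVarieties n m k ε φ := by
  obtain ⟨hlin, hmn, hsub⟩ := h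
  refine ⟨hlin, hmn, fun V _ hk => ?_⟩
  obtain ⟨W, hW, hWV⟩ := exists_submodule_hasFullRankOn hk
  refine le_trans (Nat.cast_le.mpr (Set.ncard_le_ncard (fun i hi => ?_))) (hsub W hW)
  exact fun h => hi (hWV _ (hlin i) h)

end Linear

end

/-! ### The Forbes–Shpilka construction on subspaces -/

section ForbesShpilka

variable {F : Type*} [Field F] {n m : ℕ}

/-- A subspace of dimension at least `m` contains `m` vectors in echelon form: their last nonzero
coordinates are at distinct positions. -/
theorem exists_echelon_family (m : ℕ) (W : Submodule F (Fin n → F))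
    (hW : m ≤ Module.finrank F W) :
    ∃ (p : Fin m → Fin n) (b : Fin m → Fin n → F), Function.Injective p ∧
      ∀ i, b i ∈ W ∧ b i (p i) ≠ 0 ∧ ∀ j, p i < j → b i j = 0 := by
  classical
  induction m generalizing W with
  | zero => exact ⟨Fin.elim0, Fin.elim0, fun i => i.elim0, fun i => i.elim0⟩
  | succ m ih =>
    -- Take the last position `j` at which some vector of `W` is nonzero. Killing coordinate `j`
    -- costs at most one dimension, and the remaining vectors never have `j` as a pivot.
    let s : Finset (Fin n) := Finset.univ.filter fun j => ∃ w ∈ W, w j ≠ 0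
    have hs : s.Nonempty := by
      have : Nontrivial W := Module.nontrivial_of_finrank_pos (R := F) (by omega)
      obtain ⟨⟨w, hwW⟩, hw⟩ := exists_ne (0 : W)
      obtain ⟨j, hj⟩ := Function.ne_iff.mp (fun h => hw (Subtype.ext h) : w ≠ 0)
      exact ⟨j, by simpa [s] using ⟨w, hwW, hj⟩⟩
    obtain ⟨j, hjs, hmax⟩ := s.exists_max_image id hs
    obtain ⟨w, hwW, hwj⟩ := (Finset.mem_filter.mp hjs).2
    have hmax' {v : Fin n → F} (hv : v ∈ W) {j' : Fin n} (hj' : v j' ≠ 0) : j' ≤ j :=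
      hmax j' (by simpa [s] using ⟨v, hv, hj'⟩)
    let f : W →ₗ[F] F := (LinearMap.proj j).domRestrict W
    let W' := (LinearMap.ker f).map W.subtype
    have hW' : m ≤ Module.finrank F W' := by
      have h₁ := f.finrank_range_add_finrank_ker
      have h₂ := Submodule.finrank_le (LinearMap.range f)
      rw [Module.finrank_self] at h₂
      rw [Submodule.finrank_map_subtype_eq]
      omega
    obtain ⟨p, b, hp, hb⟩ := ih W' hW'
    have hbW (i) : b i ∈ W ∧ b i j = 0 := by
      obtain ⟨⟨v, hv⟩, hvf, hvb⟩ := (hb i).1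
      rw [← hvb]
      exact ⟨hv, hvf⟩
    have hpj (i) : p i ≠ j := fun h => (hb i).2.1 (h ▸ (hbW i).2)
    refine ⟨Fin.cons j p, Fin.cons w b, Fin.cons_injective_iff.mpr ⟨?_, hp⟩, Fin.cases ?_ ?_⟩
    · rintro ⟨i, hi⟩
      exact hpj i hi
    · refine ⟨hwW, hwj, fun j' hj' => ?_⟩
      by_contra h
      exact absurd (hmax' hwW h) (not_le.mpr hj')
    · exact fun i => ⟨(hbW i).1, (hb i).2⟩

theorem sum_range_id_le_sum_of_injective {σ : Fin m → Fin n} (hσ : Function.Injective σ) :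
    ∑ i ∈ Finset.range m, i ≤ ∑ i, (σ i : ℕ) := by
  have hinj : Function.Injective fun i => ((σ i : ℕ) : ℤ) := fun i j h =>
    hσ (Fin.ext (Nat.cast_injective h))
  have := Finset.sum_range_le_sum (s := Finset.univ.image fun i => ((σ i : ℕ) : ℤ)) (c := 0)
    (by simp)
  rw [Finset.sum_image (fun _ _ _ _ h => hinj h), Finset.card_image_of_injective _ hinj] at this
  simp only [Finset.card_univ, Fintype.card_fin, zero_add] at this
  zify
  exact this

/-- The lower bound for distinct indices, applied after the reflection `j ↦ n - 1 - j`. -/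
theorem sum_le_sum_range_id_add_of_injective (hmn : m ≤ n) {σ : Fin m → Fin n}
    (hσ : Function.Injective σ) :
    ∑ i, (σ i : ℕ) ≤ ∑ i ∈ Finset.range m, i + m * (n - m) := by
  have h := sum_range_id_le_sum_of_injective (Fin.rev_injective.comp hσ)
  have h₁ : ∑ i, ((Fin.rev ∘ σ) i : ℕ) + ∑ i, (σ i : ℕ) = m * (n - 1) := by
    rw [← Finset.sum_add_distrib, Finset.sum_congr rfl (g := fun _ => n - 1)]
    · simp
    · intro i _
      simp only [Function.comp, Fin.val_rev]
      omega
  have h₂ := Finset.sum_range_id_mul_two m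
  obtain ⟨r, rfl⟩ := Nat.exists_eq_add_of_le hmn
  have h₃ : m * (m + r - 1) = m * (m - 1) + m * (m + r - m) := by
    rw [← mul_add]
    rcases m with _ | m
    · simp
    · congr 1; omega
  omega

/-- The polynomial in `s`, up to a power of `s`, whose values are the determinants of the
Forbes–Shpilka maps on the family `b`. -/
noncomputable def seedPolynomial (ω : F) (b : Fin m → Fin n → F) : Polynomial F :=
  ∑ σ : Fin m → Fin n, Polynomial.C ((∏ i, b i (σ i)) *
    (Matrix.vandermonde fun i => ω ^ (σ i : ℕ)).det) *
      Polynomial.X ^ (∑ i, (σ i : ℕ) - ∑ i ∈ Finset.range m, i)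

theorem injective_of_det_vandermonde_ne_zero {ω : F} {σ : Fin m → Fin n}
    (h : (Matrix.vandermonde fun i => ω ^ (σ i : ℕ)).det ≠ 0) : Function.Injective σ :=
  fun i j hij => Matrix.det_vandermonde_ne_zero_iff.mp h (by simp only [hij])

/-- Expand the determinant multilinearly in its rows. In the term of `σ`, row `i` has the factor `s
^ σ i`, and what remains is the Vandermonde matrix of the `ω ^ σ i`. -/
theorem det_eq_mul_eval_seedPolynomial (ω s : F) (b : Fin m → Fin n → F) :
    (Matrix.of fun i j' : Fin m => ∑ j : Fin n, b i j * (ω ^ (j' : ℕ) * s) ^ (j : ℕ)).det =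
      s ^ (∑ i ∈ Finset.range m, i) * (seedPolynomial ω b).eval s := by
  have hexp : (Matrix.of fun i j' : Fin m => ∑ j : Fin n, b i j * (ω ^ (j' : ℕ) * s) ^ (j : ℕ)).det =
      ∑ σ : Fin m → Fin n, (∏ i, b i (σ i)) *
        (Matrix.of fun i j' : Fin m => (ω ^ (j' : ℕ) * s) ^ (σ i : ℕ)).det := by
    have := (Matrix.detRowAlternating (n := Fin m) (R := F)).toMultilinearMap.map_sum
      fun i (j : Fin n) => b i j • fun j' : Fin m => (ω ^ (j' : ℕ) * s) ^ (j : ℕ)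
    simp only [MultilinearMap.map_smul_univ] at this
    refine Eq.trans (congrArg Matrix.det ?_) this
    ext i j'
    simp
  rw [hexp, seedPolynomial, Polynomial.eval_finsetSum, Finset.mul_sum]
  refine Finset.sum_congr rfl fun σ _ => ?_
  have hdet : (Matrix.of fun i j' : Fin m => (ω ^ (j' : ℕ) * s) ^ (σ i : ℕ)).det =
      s ^ (∑ i, (σ i : ℕ)) * (Matrix.vandermonde fun i => ω ^ (σ i : ℕ)).det := by
    rw [← Finset.prod_pow_eq_pow_sum, ← Matrix.det_mul_column]
    congr 1
    ext i j'
    simp only [Matrix.of_apply, Matrix.vandermonde_apply]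
    rw [mul_pow, ← pow_mul, ← pow_mul, mul_comm (j' : ℕ), mul_comm]
  rw [hdet]
  -- A nonzero Vandermonde determinant forces `σ` to be injective, and then the truncated
  -- subtraction in the exponent is a true one.
  by_cases h0 : (Matrix.vandermonde fun i => ω ^ (σ i : ℕ)).det = 0
  · simp [h0]
  · have := sum_range_id_le_sum_of_injective (injective_of_det_vandermonde_ne_zero h0)
    rw [← Nat.add_sub_cancel' this, pow_add, Polynomial.eval_mul, Polynomial.eval_C, Polynomial.eval_pow,
      Polynomial.eval_X, Nat.add_sub_cancel_left]
    ring

theorem natDegree_seedPolynomial_le (hmn : m ≤ n) (ω : F) (b : Fin m → Fin n → F) :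
    (seedPolynomial ω b).natDegree ≤ m * (n - m) := by
  refine Polynomial.natDegree_sum_le_of_forall_le _ _ fun σ _ => ?_
  by_cases h0 : (Matrix.vandermonde fun i => ω ^ (σ i : ℕ)).det = 0
  · simp [h0]
  · have := sum_le_sum_range_id_add_of_injective hmn (injective_of_det_vandermonde_ne_zero h0)
    exact (Polynomial.natDegree_C_mul_X_pow_le _ _).trans (by omega)

/-- By the echelon form only `σ ≤ p` contribute, so `σ = p` alone reaches the exponent of `p`. Its
coefficient is nonzero because the pivots are nonzero and the powers `ω ^ p i` are distinct. -/
theorem seedPolynomial_ne_zero {ω : F} (hω : Function.Injective fun j : Fin n => ω ^ (j : ℕ))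
    {p : Fin m → Fin n} {b : Fin m → Fin n → F} (hp : Function.Injective p)
    (hb : ∀ i, b i (p i) ≠ 0 ∧ ∀ j, p i < j → b i j = 0) : seedPolynomial ω b ≠ 0 := by
  classical
  suffices h : (seedPolynomial ω b).coeff (∑ i, (p i : ℕ) - ∑ i ∈ Finset.range m, i) =
      (∏ i, b i (p i)) * (Matrix.vandermonde fun i => ω ^ (p i : ℕ)).det by
    intro h0
    rw [h0, Polynomial.coeff_zero, eq_comm, mul_eq_zero, Finset.prod_eq_zero_iff] at h
    rcases h with ⟨i, -, hi⟩ | h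
    · exact (hb i).1 hi
    · exact Matrix.det_vandermonde_ne_zero_iff.mpr (hω.comp hp) h
  rw [seedPolynomial, Polynomial.finsetSum_coeff, Finset.sum_eq_single p]
  · rw [Polynomial.coeff_C_mul, Polynomial.coeff_X_pow_self, mul_one]
  · intro σ _ hσ
    rw [Polynomial.coeff_C_mul, Polynomial.coeff_X_pow]
    by_cases hb0 : ∏ i, b i (σ i) = 0
    · simp [hb0]
    by_cases h0 : (Matrix.vandermonde fun i => ω ^ (σ i : ℕ)).det = 0
    · simp [h0]
    rw [if_neg, mul_zero]
    intro heq
    have h₁ := sum_range_id_le_sum_of_injective hp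
    have h₂ := sum_range_id_le_sum_of_injective (injective_of_det_vandermonde_ne_zero h0)
    have hle (i) : (σ i : ℕ) ≤ p i := by
      by_contra h
      exact hb0 (Finset.prod_eq_zero (Finset.mem_univ i) ((hb i).2 _ (not_le.mp h)))
    have hsum : ∑ i, (σ i : ℕ) = ∑ i, (p i : ℕ) := by omega
    refine hσ (funext fun i => Fin.ext ?_)
    exact (Finset.sum_eq_sum_iff_of_le fun i _ => hle i).mp hsum i (Finset.mem_univ i)
  · simp

theorem forbesShpilkaMap_isLinear (ω s : Fˣ) : (forbesShpilkaMap n m ω s).IsLinear := by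
  intro j'
  refine MvPolynomial.IsHomogeneous.sum _ _ _ fun j _ => ?_
  exact (MvPolynomial.isHomogeneous_X F j).C_mul _

theorem forbesShpilkaMap_toFun (ω s : Fˣ) (x : Fin n → F) (j' : Fin m) :
    (forbesShpilkaMap n m ω s).toFun x j' =
      ∑ j : Fin n, x j * ((ω : F) ^ (j' : ℕ) * s) ^ (j : ℕ) := by
  simp [PolyMap.toFun, forbesShpilkaMap, mul_comm]

/-- If the seed polynomial of a family in `W` does not vanish at `s`, then the Forbes–Shpilka map is
onto on `W`. -/
theorem forbesShpilkaMap_surjective {ω s : Fˣ} {W : Submodule F (Fin n → F)}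
    {b : Fin m → Fin n → F} (hb : ∀ i, b i ∈ W) (h : (seedPolynomial (ω : F) b).eval (s : F) ≠ 0)
    (y : Fin m → F) : ∃ w ∈ W, (forbesShpilkaMap n m ω s).toFun w = y := by
  let M : Matrix (Fin m) (Fin m) F :=
    Matrix.of fun i j' => ∑ j : Fin n, b i j * ((ω : F) ^ (j' : ℕ) * s) ^ (j : ℕ)
  have hM : IsUnit M := by
    rw [Matrix.isUnit_iff_isUnit_det, isUnit_iff_ne_zero, det_eq_mul_eval_seedPolynomial]
    exact mul_ne_zero (pow_ne_zero _ s.ne_zero) h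
  obtain ⟨v, hv⟩ := Matrix.vecMul_surjective_iff_isUnit.mpr hM y
  refine ⟨∑ i, v i • b i, W.sum_mem fun i _ => W.smul_mem _ (hb i), ?_⟩
  rw [← hv]
  ext j'
  rw [forbesShpilkaMap_toFun]
  simp only [Matrix.vecMul, dotProduct, M, Matrix.of_apply, Finset.sum_apply, Pi.smul_apply,
    smul_eq_mul, Finset.sum_mul, Finset.mul_sum]
  rw [Finset.sum_comm]
  simp only [mul_assoc]

theorem pow_injective_of_le_orderOf {G : Type*} [Group G] {ω : G}
    (h : ¬ IsOfFinOrder ω ∨ n ≤ orderOf ω) : Function.Injective fun j : Fin n => ω ^ (j : ℕ) := by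
  intro i j hij
  refine Fin.ext ?_
  rcases h with h | h
  · exact injective_pow_iff_not_isOfFinOrder.mpr h hij
  · exact pow_injOn_Iio_orderOf (i.2.trans_le h) (j.2.trans_le h) hij

theorem forbesShpilkaMap_isLinearSeededRankExtractorForSubspaces [IsAlgClosed F] {ℓ : ℕ} {ω : Fˣ}
    {s : Fin ℓ → Fˣ} (hmn : m ≤ n) (hω : ¬ IsOfFinOrder ω ∨ n ≤ orderOf ω)
    (hs : Function.Injective s) :
    IsLinearSeededRankExtractorForSubspaces n m m ((m : ℝ) * ((n : ℝ) - (m : ℝ)) / (ℓ : ℝ))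
      (fun i => forbesShpilkaMap n m ω (s i)) := by
  classical
  refine ⟨fun i => forbesShpilkaMap_isLinear ω (s i), hmn, fun W hW => ?_⟩
  rcases Nat.eq_zero_or_pos ℓ with rfl | hℓ
  · simp [Set.eq_empty_of_isEmpty]
  rw [div_mul_cancel₀ _ (by positivity), ← Nat.cast_sub hmn, ← Nat.cast_mul, Nat.cast_le]
  obtain ⟨p, b, hp, hb⟩ := exists_echelon_family m W hW
  have hωF : Function.Injective fun j : Fin n => (ω : F) ^ (j : ℕ) := fun i j hij =>
    pow_injective_of_le_orderOf hω (Units.ext (by simpa using hij))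
  have hne := seedPolynomial_ne_zero hωF hp fun i => (hb i).2
  -- Bad seeds are roots of one nonzero polynomial depending only on `W`. As the seeds are distinct,
  -- its degree bounds their number.
  have hroot (i : Fin ℓ) (hi : ¬ HasFullRankOn (forbesShpilkaMap n m ω (s i)) (W : Set (Fin n → F))) :
      (s i : F) ∈ (seedPolynomial (ω : F) b).roots.toFinset := by
    rw [Multiset.mem_toFinset, Polynomial.mem_roots hne]
    by_contra h
    rw [hasFullRankOn_iff_isDominantOn] at hi
    exact hi (isDominantOn_of_surjective (forbesShpilkaMap_surjective (fun i => (hb i).1) h))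
  refine le_trans (Set.ncard_le_ncard_of_injOn (fun i => (s i : F)) hroot
    (fun i _ j _ hij => hs (Units.ext hij))) ?_
  rw [Set.ncard_coe_finset]
  exact (Multiset.toFinset_card_le _).trans ((Polynomial.card_roots' _).trans
    (natDegree_seedPolynomial_le hmn _ _))

end ForbesShpilka

end RankExtractor

theorem mainTheorem6 {F : Type*} [Field F] [IsAlgClosed F] :
    -- linear seeded rank extractors for subspaces are such extractors for varieties
    (∀ (n m k ℓ : ℕ) (ε : ℝ) (φ : Fin ℓ → RankExtractor.PolyMap F n m),
      RankExtractor.IsLinearSeededRankExtractorForSubspaces n m k ε φ →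
        RankExtractor.IsLinearSeededRankExtractorForVarieties n m k ε φ) ∧
    -- full rank on a variety is the same as dominance
    (∀ (n m : ℕ) (φ : RankExtractor.PolyMap F n m) (V : Set (Fin n → F)),
      RankExtractor.IsAffineVariety V →
        (RankExtractor.HasFullRankOn φ V ↔ RankExtractor.IsDominantOn φ V)) ∧
    -- the Forbes–Shpilka construction; the order of `ω` is infinite or at least `n`
    (∀ (n m ℓ : ℕ) (ω : Fˣ) (s : Fin ℓ → Fˣ), 1 ≤ m → m ≤ n →
      (¬ IsOfFinOrder ω ∨ n ≤ orderOf ω) → Function.Injective s →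
        RankExtractor.IsLinearSeededRankExtractorForVarieties n m m
          ((m : ℝ) * ((n : ℝ) - (m : ℝ)) / (ℓ : ℝ))
          (fun i => RankExtractor.forbesShpilkaMap n m ω (s i))) := by
  refine ⟨fun n m k ℓ ε φ h => ?_, fun n m φ V _ => ?_, fun n m ℓ ω s _ hmn hω hs => ?_⟩
  · exact RankExtractor.isLinearSeededRankExtractorForVarieties_of_subspaces h
  · exact RankExtractor.hasFullRankOn_iff_isDominantOn φ V
  · exact RankExtractor.isLinearSeededRankExtractorForVarieties_of_subspaces
      (RankExtractor.forbesShpilkaMap_isLinearSeededRankExtractorForSubspaces hmn hω hs)
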